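/- Let $d\ge 0$ and $m\ge 1$ be integers, write $\mathbb R_+=(0,\infty)$, and let $\mu:\mathbb R_{\ge 0}\times\mathbb R^d\to\mathbb R$, $(x,y)\mapsto\mu(x,y)$, be of class $C^m$ (up to the boundary $x=0$). For a multi-index $\alpha=(\alpha_1,\dots,\alpha_{d+1})\in\mathbb N_0^{1+d}$ let $D^\alpha\mu$ be the corresponding partial derivative, the first entry of $\alpha$ referring to $x$. Assume: (Growth, a) for each integer $0\le l\le m$ there are $a_l\in L^2(\mathbb R_+)$ and a locally bounded $b_l:\mathbb R^d\to[0,\infty)$ such that $$|D^{(l,0,\dots,0)}\mu(x,y)|\le a_l(x)+b_l(y)\,|y|\qquad\text{for all }x\in\mathbb R_+,\ y\in\mathbb R^d;$$ (Growth, b) for each multi-index $\alpha$ with $\alpha_1\ne|\alpha|\le m$, the function $y\mapsto\sup_{x\in\mathbb R_+}|D^\alpha\mu(x,y)|$ is (finite and) locally bounded on $\mathbb R^d$; (Uniform local Lipschitz) for every $r\ge 0$ there is $L_r\ge 0$ such that $$|D^\alpha\mu(x,y)-D^\alpha\mu(x,z)|\le L_r|y-z|$$ for all $|\alpha|\le m$,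 all $x\ge 0$ and all $y,z\in\mathbb R^d$ with $|y|,|z|\le r$. Then for every $u\in (H^m(\mathbb R_+))^d$ the function $N(u)(x)=\mu(x,u(x))$ belongs to $H^m(\mathbb R_+)$, and the Nemytskii operator $N:(H^m(\mathbb R_+))^d\to H^m(\mathbb R_+)$ is Lipschitz continuous on every bounded subset of $(H^m(\mathbb R_+))^d$. Here $H^m(\mathbb R_+)$ is the $L^2$-based Sobolev space of order $m$ with $\|f\|_{H^m}^2=\sum_{k=0}^m\|f^{(k)}\|_{L^2(\mathbb R_+)}^2$, and $(H^m(\mathbb R_+))^d$ has the product norm $\|u\|^2=\sum_{j=1}^d\|u_j\|_{H^m}^2$. -/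

import Mathlib

open MeasureTheory Set Filter
open scoped ContDiff NNReal

/-! ### Sobolev spaces on the half-line `(0, ∞)` -/

/-- Lebesgue measure on the open half-line `(0, ∞)`. -/
noncomputable abbrev halfLine : Measure ℝ := volume.restrict (Ioi (0 : ℝ))

/-- `g` is the `k`-th weak derivative of `f` on `(0, ∞)`: for all test functions
`φ ∈ C_c^∞((0, ∞))`, `∫ f φ⁽ᵏ⁾ = (-1)ᵏ ∫ g φ`. (Used only for square integrable `f`, `g`.) -/
def IsWeakDeriv (k : ℕ) (f g : ℝ → ℝ) : Prop :=
  ∀ φ : ℝ → ℝ, ContDiff ℝ ∞ φ → HasCompactSupport φ → tsupport φ ⊆ Ioi 0 →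
    ∫ x, f x * iteratedDeriv k φ x ∂halfLine = (-1) ^ k * ∫ x, g x * φ x ∂halfLine

theorem integrable_mul_test {f φ : ℝ → ℝ} (hf : MemLp f 2 halfLine)
    (hφ : Continuous φ) (hc : HasCompactSupport φ) :
    Integrable (fun x => f x * φ x) halfLine :=
  have h : MemLp φ 2 halfLine := hφ.memLp_of_hasCompactSupport hc
  hf.integrable_mul h

theorem hasCompactSupport_iteratedDeriv {φ : ℝ → ℝ} (hc : HasCompactSupport φ) (k : ℕ) :
    HasCompactSupport (iteratedDeriv k φ) := by
  induction k with
  | zero => simpa using hc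
  | succ k ih => rw [iteratedDeriv_succ]; exact ih.deriv

theorem continuous_iteratedDeriv_test {φ : ℝ → ℝ} (hφ : ContDiff ℝ ∞ φ) (k : ℕ) :
    Continuous (iteratedDeriv k φ) :=
  hφ.continuous_iteratedDeriv k (by exact_mod_cast le_top)

theorem IsWeakDeriv.congr {k : ℕ} {f f' g g' : ℝ → ℝ} (h : IsWeakDeriv k f g)
    (hf : f' =ᵐ[halfLine] f) (hg : g' =ᵐ[halfLine] g) : IsWeakDeriv k f' g' := by
  intro φ h1 h2 h3
  have e1 : ∫ x, f' x * iteratedDeriv k φ x ∂halfLine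
      = ∫ x, f x * iteratedDeriv k φ x ∂halfLine :=
    integral_congr_ae (by filter_upwards [hf] with x hx; rw [hx])
  have e2 : ∫ x, g' x * φ x ∂halfLine = ∫ x, g x * φ x ∂halfLine :=
    integral_congr_ae (by filter_upwards [hg] with x hx; rw [hx])
  rw [e1, e2]; exact h φ h1 h2 h3

theorem IsWeakDeriv.add {k : ℕ} {f f' g g' : ℝ → ℝ}
    (hf : MemLp f 2 halfLine) (hf' : MemLp f' 2 halfLine)
    (hg : MemLp g 2 halfLine) (hg' : MemLp g' 2 halfLine)
    (h : IsWeakDeriv k f g) (h' : IsWeakDeriv k f' g') :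
    IsWeakDeriv k (f + f') (g + g') := by
  intro φ h1 h2 h3
  have c := continuous_iteratedDeriv_test h1 k
  have s := hasCompactSupport_iteratedDeriv h2 k
  simp only [Pi.add_apply, add_mul]
  rw [integral_add (integrable_mul_test hf c s) (integrable_mul_test hf' c s),
    integral_add (integrable_mul_test hg h1.continuous h2)
      (integrable_mul_test hg' h1.continuous h2), h φ h1 h2 h3, h' φ h1 h2 h3, mul_add]

theorem IsWeakDeriv.smul {k : ℕ} {f g : ℝ → ℝ} (c : ℝ) (h : IsWeakDeriv k f g) :
    IsWeakDeriv k (c • f) (c • g) := by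
  intro φ h1 h2 h3
  simp only [Pi.smul_apply, smul_eq_mul, mul_assoc]
  rw [integral_const_mul, integral_const_mul, h φ h1 h2 h3]
  ring

/-- The Sobolev space `H^m(0, ∞)`. A function `f ∈ H^m` is recorded together with its weak
derivatives as the tuple `(f, f', …, f⁽ᵐ⁾)` in `(L²(0, ∞))^{m+1}`; the derivatives are determined
by `f` (see `sobolevSpace_ext`). The norm is thus the usual one,
`‖f‖² = ∑_{k ≤ m} ‖f⁽ᵏ⁾‖²_{L²}`. -/
noncomputable def sobolevSubmodule (m : ℕ) :
    Submodule ℝ (PiLp 2 (fun _ : Fin (m + 1) => Lp ℝ 2 halfLine)) where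
  carrier := {F | ∀ k : Fin (m + 1), IsWeakDeriv k (F 0) (F k)}
  zero_mem' := by
    intro k φ _ _ _
    have h0 : ((0 : Lp ℝ 2 halfLine) : ℝ → ℝ) =ᵐ[halfLine] 0 := Lp.coeFn_zero ℝ 2 halfLine
    have z : ∀ ψ : ℝ → ℝ, ∫ x, ((0 : Lp ℝ 2 halfLine) : ℝ → ℝ) x * ψ x ∂halfLine = 0 := by
      intro ψ
      apply integral_eq_zero_of_ae
      filter_upwards [h0] with x hx
      rw [hx]
      simp
    simp only [PiLp.zero_apply]
    rw [z, z, mul_zero]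
  add_mem' := by
    intro F G hF hG k
    exact ((hF k).add (Lp.memLp _) (Lp.memLp _) (Lp.memLp _) (Lp.memLp _) (hG k)).congr
      (Lp.coeFn_add _ _) (Lp.coeFn_add _ _)
  smul_mem' := by
    intro c F hF k
    exact ((hF k).smul c).congr (Lp.coeFn_smul _ _) (Lp.coeFn_smul _ _)

/-- `H^m(ℝ₊)` as a normed space. -/
noncomputable abbrev SobolevSpace (m : ℕ) : Type := sobolevSubmodule m

/-- (A representative of) the function underlying an element of `H^m(ℝ₊)`. -/
noncomputable def SobolevSpace.toFun {m : ℕ} (u : SobolevSpace m) : ℝ → ℝ :=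
  (u.1 0 : Lp ℝ 2 halfLine)

/-- The product `(H^m(ℝ₊))^d` with its Hilbert product norm. -/
noncomputable abbrev SobolevSpacePow (m d : ℕ) : Type :=
  PiLp 2 (fun _ : Fin d => SobolevSpace m)

/-- The `ℝ^d`-valued function underlying an element of `(H^m(ℝ₊))^d`. -/
noncomputable def SobolevSpacePow.toFun {m d : ℕ} (u : SobolevSpacePow m d) :
    ℝ → EuclideanSpace ℝ (Fin d) :=
  fun x => WithLp.toLp 2 (fun j => (u j).toFun x)

/-- An element of `H^m(ℝ₊)` is determined by its underlying function. -/
theorem sobolevSpace_ext {m : ℕ} {u v : SobolevSpace m}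
    (h : u.toFun =ᵐ[halfLine] v.toFun) : u = v := by
  apply Subtype.ext
  apply PiLp.ext
  intro k
  have hw : IsWeakDeriv k (u.1 0 : Lp ℝ 2 halfLine) (v.1 k : Lp ℝ 2 halfLine) :=
    (v.2 k).congr h EventuallyEq.rfl
  have hu := u.2 k
  have hd : MemLp (fun x => (u.1 k : Lp ℝ 2 halfLine) x - (v.1 k : Lp ℝ 2 halfLine) x) 2
      halfLine := (Lp.memLp (u.1 k)).sub (Lp.memLp (v.1 k))
  have key := isOpen_Ioi.ae_eq_zero_of_integral_contDiff_smul_eq_zero (μ := (volume : Measure ℝ))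
    (U := Ioi (0 : ℝ))
    (f := fun x => (u.1 k : Lp ℝ 2 halfLine) x - (v.1 k : Lp ℝ 2 halfLine) x)
    (locallyIntegrableOn_of_locallyIntegrable_restrict (hd.locallyIntegrable (by norm_num)))
    (by
      intro φ h1 h2 h3
      have e := (hu φ h1 h2 h3).symm.trans (hw φ h1 h2 h3)
      have e' := mul_left_cancel₀ (pow_ne_zero _ (by norm_num)) e
      have hs : ∫ x, φ x • ((u.1 k : Lp ℝ 2 halfLine) x - (v.1 k : Lp ℝ 2 halfLine) x)
          = ∫ x, φ x • ((u.1 k : Lp ℝ 2 halfLine) x - (v.1 k : Lp ℝ 2 halfLine) x)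
            ∂halfLine := by
        symm
        apply setIntegral_eq_integral_of_forall_compl_eq_zero
        intro x hx
        have : φ x = 0 := image_eq_zero_of_notMem_tsupport (fun hh => hx (h3 hh))
        simp [this]
      rw [hs]
      have : ∀ x, φ x • ((u.1 k : Lp ℝ 2 halfLine) x - (v.1 k : Lp ℝ 2 halfLine) x)
          = (u.1 k : Lp ℝ 2 halfLine) x * φ x - (v.1 k : Lp ℝ 2 halfLine) x * φ x := by
        intro x; simp only [smul_eq_mul]; ring
      simp only [this]
      rw [integral_sub (integrable_mul_test (Lp.memLp _) h1.continuous h2)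
        (integrable_mul_test (Lp.memLp _) h1.continuous h2), e', sub_self])
  apply Lp.ext
  have key' := (ae_restrict_iff' (measurableSet_Ioi (a := (0 : ℝ)))).2 key
  filter_upwards [key'] with x hx
  exact sub_eq_zero.1 hx

/-! ### Partial derivatives and the assumptions on `μ` -/

/-- The closed half-space `ℝ_{≥0} × ℝ^d`. -/
def halfSpace (d : ℕ) : Set (ℝ × EuclideanSpace ℝ (Fin d)) := Ici (0 : ℝ) ×ˢ univ

/-- The coordinate directions of `ℝ × ℝ^d`: index `0` is the `x`-direction and index `j + 1` the
`y_j`-direction. -/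
noncomputable def coordDir (d : ℕ) : Fin (d + 1) → ℝ × EuclideanSpace ℝ (Fin d) :=
  Fin.cases (1, 0) (fun j => (0, EuclideanSpace.single j 1))

/-- The partial derivative `D^α μ` on the closed half-space, for a multi-index
`α = (α₀, …, α_d)`: the total derivative of order `|α| = ∑ αᵢ` applied to the tuple in which the
`i`-th coordinate direction is repeated `αᵢ` times. On the boundary the derivative is the one
taken within the half-space. -/
noncomputable def multiDeriv {d : ℕ} (α : Fin (d + 1) → ℕ)
    (μ : ℝ × EuclideanSpace ℝ (Fin d) → ℝ) (z : ℝ × EuclideanSpace ℝ (Fin d)) : ℝ :=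
  iteratedFDerivWithin ℝ (∑ i, α i) μ (halfSpace d) z
    (fun p => coordDir d (finSigmaFinEquiv.symm p).1)

/-- The growth assumption of order `m`: `μ ∈ C^m(ℝ_{≥0} × ℝ^d)`, and
(a) the pure `x`-derivatives of order `l ≤ m` satisfy
`|∂ₓˡ μ(x, y)| ≤ a_l(x) + b_l(y) |y|` with `a_l ∈ L²(ℝ₊)` and `b_l ≥ 0` locally bounded;
(b) for every other multi-index of order `≤ m`, `sup_{x > 0} |D^α μ(x, ·)|` is locally bounded. -/
structure GrowthAssumption {d : ℕ} (m : ℕ) (μ : ℝ × EuclideanSpace ℝ (Fin d) → ℝ) : Prop where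
  contDiffOn : ContDiffOn ℝ m μ (halfSpace d)
  pure_x : ∀ l : ℕ, l ≤ m → ∃ (a : ℝ → ℝ) (b : EuclideanSpace ℝ (Fin d) → ℝ),
    MemLp a 2 halfLine ∧ (∀ y, 0 ≤ b y) ∧ (∀ r : ℝ, ∃ C : ℝ, ∀ y, ‖y‖ ≤ r → b y ≤ C) ∧
    ∀ x : ℝ, 0 < x → ∀ y, |multiDeriv (Pi.single 0 l) μ (x, y)| ≤ a x + b y * ‖y‖
  mixed : ∀ α : Fin (d + 1) → ℕ, α 0 ≠ ∑ i, α i → ∑ i, α i ≤ m →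
    ∀ r : ℝ, ∃ C : ℝ, ∀ y, ‖y‖ ≤ r → ∀ x : ℝ, 0 < x → |multiDeriv α μ (x, y)| ≤ C

/-- The local Lipschitz assumption of order `m`: `μ ∈ C^m(ℝ_{≥0} × ℝ^d)` and all `D^α μ(x, ·)`,
`|α| ≤ m`, are locally Lipschitz, with constants independent of `x ≥ 0`. -/
structure LipschitzAssumption {d : ℕ} (m : ℕ) (μ : ℝ × EuclideanSpace ℝ (Fin d) → ℝ) : Prop where
  contDiffOn : ContDiffOn ℝ m μ (halfSpace d)
  lipschitz : ∀ r : ℝ, 0 ≤ r → ∃ L : ℝ, 0 ≤ L ∧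
    ∀ α : Fin (d + 1) → ℕ, ∑ i, α i ≤ m → ∀ x : ℝ, 0 ≤ x → ∀ y z, ‖y‖ ≤ r → ‖z‖ ≤ r →
      |multiDeriv α μ (x, y) - multiDeriv α μ (x, z)| ≤ L * ‖y - z‖

/-- The Nemytskii (superposition) operator on functions, `N(u)(x) = μ(x, u(x))`. -/
def nemytskii {d : ℕ} (μ : ℝ × EuclideanSpace ℝ (Fin d) → ℝ)
    (u : ℝ → EuclideanSpace ℝ (Fin d)) : ℝ → ℝ :=
  fun x => μ (x, u x)

/-! Every derivative of order below `m` of an `H^m` function has an absolutely continuous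
representative, and the composition of a `C¹` function with absolutely continuous functions is again
absolutely continuous. Hence `N(u)' = ∂ₓμ(x,u) + ∑ ∂_jμ(x,u) u_j'` almost everywhere, and this can
be iterated. The terms that arise are of two kinds. Pure `x`-derivatives of `μ` at `(x, u(x))` are
square integrable by growth (a). All others are a mixed derivative of `μ`, bounded by growth (b)
because `u` is bounded, times a factor in some `H^k`.

Regularity, bounds and Lipschitz estimates are proved together, for families indexed by a metric
space `X`, in the end a bounded set of `(H^m)^d`. `SobLip k` says that such a family is bounded and
Lipschitz in `H^k`. The analytic inputs are the embedding of `H¹` in `L^∞` (`HasACDeriv.enorm_le`,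
`SobLip.linfLip`), the product rule `H^k · H^{k+1} ⊂ H^k` (`SobLip.mul`) and the chain rule
`HasACDeriv.nemytskii`. Two inductions on `k` conclude: `SobLip.wordDeriv_mul` for mixed terms and
`SobLip.wordDeriv_replicate` for pure ones. Partial derivatives are indexed by words of directions,
which the chain rule produces directly; `multiDeriv_eq_wordDeriv` converts them to multi-indices. -/

/-! ### Absolutely continuous functions on the half-line -/

/-- `f` is absolutely continuous on bounded subintervals of `[0, ∞)`, with derivative `g`
almost everywhere. -/
def HasACDeriv (f g : ℝ → ℝ) : Prop :=
  (∀ b, 0 < b → AbsolutelyContinuousOnInterval f 0 b) ∧ ∀ᵐ x ∂halfLine, HasDerivAt f (g x) x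

theorem HasACDeriv.congr_right {f g g' : ℝ → ℝ} (h : HasACDeriv f g) (hg : g' =ᵐ[halfLine] g) :
    HasACDeriv f g' :=
  ⟨h.1, by filter_upwards [h.2, hg] with x h1 h2; rwa [h2]⟩

theorem hasACDeriv_const (c : ℝ) : HasACDeriv (fun _ => c) (fun _ => 0) :=
  ⟨fun _ _ => (contDiffOn_const (c := c)).absolutelyContinuousOnInterval,
    .of_forall fun x => hasDerivAt_const x c⟩

theorem HasACDeriv.add {f f' g g' : ℝ → ℝ} (hf : HasACDeriv f f') (hg : HasACDeriv g g') :
    HasACDeriv (fun x => f x + g x) (fun x => f' x + g' x) :=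
  ⟨fun b hb => (hf.1 b hb).add (hg.1 b hb), by
    filter_upwards [hf.2, hg.2] with x h1 h2 using h1.add h2⟩

theorem HasACDeriv.sub {f f' g g' : ℝ → ℝ} (hf : HasACDeriv f f') (hg : HasACDeriv g g') :
    HasACDeriv (fun x => f x - g x) (fun x => f' x - g' x) :=
  ⟨fun b hb => (hf.1 b hb).sub (hg.1 b hb), by
    filter_upwards [hf.2, hg.2] with x h1 h2 using h1.sub h2⟩

theorem HasACDeriv.mul {f f' g g' : ℝ → ℝ} (hf : HasACDeriv f f') (hg : HasACDeriv g g') :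
    HasACDeriv (fun x => f x * g x) (fun x => f' x * g x + f x * g' x) :=
  ⟨fun b hb => (hf.1 b hb).mul (hg.1 b hb), by
    filter_upwards [hf.2, hg.2] with x h1 h2 using h1.mul h2⟩

theorem HasACDeriv.sum {ι : Type*} (s : Finset ι) {f f' : ι → ℝ → ℝ}
    (h : ∀ i ∈ s, HasACDeriv (f i) (f' i)) :
    HasACDeriv (fun x => ∑ i ∈ s, f i x) (fun x => ∑ i ∈ s, f' i x) := by
  classical
  induction s using Finset.induction_on with
  | empty => simpa using hasACDeriv_const 0
  | insert i s hi ih =>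
    simp only [Finset.sum_insert hi]
    exact (h i (by simp)).add (ih fun j hj => h j (by simp [hj]))

theorem HasACDeriv.continuousOn {f g : ℝ → ℝ} (h : HasACDeriv f g) : ContinuousOn f (Ici 0) := by
  intro x hx
  have hx0 : (0 : ℝ) ≤ x := hx
  have h1 := (h.1 (x + 1) (by linarith)).continuousOn
  rw [uIcc_of_le (by linarith)] at h1
  refine (h1 x ⟨hx0, by linarith⟩).mono_of_mem_nhdsWithin ?_
  rw [← Ici_inter_Iic]
  exact inter_mem self_mem_nhdsWithin (mem_nhdsWithin_of_mem_nhds (Iic_mem_nhds (by linarith)))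

theorem HasACDeriv.absolutelyContinuousOnInterval {f g : ℝ → ℝ} (h : HasACDeriv f g) {a b : ℝ}
    (ha : 0 ≤ a) (hb : 0 ≤ b) : AbsolutelyContinuousOnInterval f a b := by
  have hp : 0 < max a b + 1 := by linarith [le_max_left a b]
  refine (h.1 _ hp).mono ?_
  rw [uIcc_of_le hp.le]
  intro x hx
  exact ⟨(le_min ha hb).trans hx.1, hx.2.trans (by linarith)⟩

theorem HasACDeriv.deriv_ae {f g : ℝ → ℝ} (h : HasACDeriv f g) {a b : ℝ}
    (ha : 0 ≤ a) (hb : 0 ≤ b) : ∀ᵐ x, x ∈ uIoc a b → deriv f x = g x := by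
  have h2 := (ae_restrict_iff' (measurableSet_Ioi (a := (0 : ℝ)))).1 h.2
  filter_upwards [h2] with x hx hxab
  exact (hx ((le_min ha hb).trans_lt hxab.1)).deriv

theorem HasACDeriv.intervalIntegrable {f g : ℝ → ℝ} (h : HasACDeriv f g) {a b : ℝ}
    (ha : 0 ≤ a) (hb : 0 ≤ b) : IntervalIntegrable g volume a b := by
  refine (h.absolutelyContinuousOnInterval ha hb).intervalIntegrable_deriv.congr_ae ?_
  exact (ae_restrict_iff' measurableSet_uIoc).2 (h.deriv_ae ha hb)

theorem HasACDeriv.integral_eq_sub {f g : ℝ → ℝ} (h : HasACDeriv f g) {a b : ℝ}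
    (ha : 0 ≤ a) (hb : 0 ≤ b) : ∫ x in a..b, g x = f b - f a := by
  rw [← (h.absolutelyContinuousOnInterval ha hb).integral_deriv_eq_sub]
  refine intervalIntegral.integral_congr_ae ?_
  filter_upwards [h.deriv_ae ha hb] with x hx hx' using (hx hx').symm

theorem ContinuousOn.aestronglyMeasurable_halfLine {f : ℝ → ℝ} (h : ContinuousOn f (Ici 0)) :
    AEStronglyMeasurable f halfLine :=
  (h.mono Ioi_subset_Ici_self).aestronglyMeasurable measurableSet_Ioi

theorem integral_halfLine_eq_intervalIntegral {f : ℝ → ℝ} {b : ℝ} (hb : 0 ≤ b)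
    (h : ∀ x, b < x → f x = 0) : ∫ x, f x ∂halfLine = ∫ x in (0 : ℝ)..b, f x := by
  rw [intervalIntegral.integral_of_le hb]
  refine setIntegral_eq_of_subset_of_forall_sdiff_eq_zero measurableSet_Ioi Ioc_subset_Ioi_self ?_
  intro x hx
  exact h x (not_le.1 fun hxb => hx.2 ⟨hx.1, hxb⟩)

theorem HasCompactSupport.exists_pos_forall_lt_eq_zero {φ : ℝ → ℝ} (hc : HasCompactSupport φ) :
    ∃ b : ℝ, 0 < b ∧ ∀ x, b ≤ x → φ x = 0 := by
  obtain ⟨b, hb⟩ := hc.isCompact.bddAbove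
  refine ⟨max b 0 + 1, by positivity, fun x hx => ?_⟩
  refine image_eq_zero_of_notMem_tsupport fun hm => ?_
  have := hb hm
  linarith [le_max_left b 0]

/-- Integration by parts against a test function. -/
theorem HasACDeriv.integral_mul_deriv_test {f g φ : ℝ → ℝ} (h : HasACDeriv f g)
    (hφ : ContDiff ℝ ∞ φ) (hc : HasCompactSupport φ) (hs : tsupport φ ⊆ Ioi 0) :
    ∫ x, f x * deriv φ x ∂halfLine = -∫ x, g x * φ x ∂halfLine := by
  obtain ⟨b, hb, hz⟩ := hc.exists_pos_forall_lt_eq_zero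
  have hz0 : φ 0 = 0 := image_eq_zero_of_notMem_tsupport fun hm => lt_irrefl (0 : ℝ) (hs hm)
  have hdz : ∀ x, b < x → deriv φ x = 0 := by
    intro x hx
    have : φ =ᶠ[nhds x] fun _ => 0 := by
      filter_upwards [Ioi_mem_nhds hx] with y hy using hz y (le_of_lt hy)
    rw [this.deriv_eq]; simp
  rw [integral_halfLine_eq_intervalIntegral hb.le fun x hx => by rw [hdz x hx, mul_zero],
    integral_halfLine_eq_intervalIntegral hb.le fun x hx => by rw [hz x hx.le, mul_zero],
    AbsolutelyContinuousOnInterval.integral_mul_deriv_eq_deriv_mul (h.1 b hb)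
      (hφ.of_le (by exact_mod_cast le_top)).contDiffOn.absolutelyContinuousOnInterval,
    hz b le_rfl, hz0, mul_zero, mul_zero, sub_zero, zero_sub]
  congr 1
  refine intervalIntegral.integral_congr_ae ?_
  filter_upwards [h.deriv_ae le_rfl hb.le] with x hx hx'
  rw [hx hx']

/-- The one-dimensional Sobolev inequality on the half-line. -/
theorem HasACDeriv.enorm_le {f g : ℝ → ℝ} (h : HasACDeriv f g) (hg : AEStronglyMeasurable g halfLine)
    {x : ℝ} (hx : 0 < x) : ‖f x‖ₑ ≤ eLpNorm f 2 halfLine + eLpNorm g 2 halfLine := by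
  have hle : volume.restrict (Ioc x (x + 1)) ≤ halfLine :=
    Measure.restrict_mono (fun y hy => hx.trans hy.1) le_rfl
  -- The estimate averages `|f x| ≤ |f y| + ∫ |g|` over `y` in a unit interval; since it has mass
  -- one, `L¹` norms are at most `L²` norms and no constant appears.
  have : IsProbabilityMeasure (volume.restrict (Ioc x (x + 1))) := ⟨by simp⟩
  have hfm := h.continuousOn.aestronglyMeasurable_halfLine
  have key : ∀ {k : ℝ → ℝ}, AEStronglyMeasurable k halfLine →
      ∫⁻ y in Ioc x (x + 1), ‖k y‖ₑ ≤ eLpNorm k 2 halfLine := by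
    intro k hk
    rw [← eLpNorm_one_eq_lintegral_enorm]
    exact (eLpNorm_le_eLpNorm_of_exponent_le (by norm_num) (hk.mono_measure hle)).trans
      (eLpNorm_mono_measure _ hle)
  have hpt : ∀ y ∈ Ioc x (x + 1), ‖f x‖ₑ ≤ ‖f y‖ₑ + ∫⁻ t in Ioc x (x + 1), ‖g t‖ₑ := by
    intro y hy
    have e := h.integral_eq_sub hx.le (hx.le.trans hy.1.le)
    have e' : f x = f y - ∫ t in x..y, g t := by rw [e]; ring
    rw [e']
    refine enorm_sub_le.trans (add_le_add le_rfl ?_)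
    rw [intervalIntegral.integral_of_le hy.1.le]
    refine (enorm_integral_le_lintegral_enorm _).trans ?_
    exact lintegral_mono_set (Ioc_subset_Ioc_right hy.2)
  calc ‖f x‖ₑ = ∫⁻ y in Ioc x (x + 1), ‖f x‖ₑ := by simp
    _ ≤ ∫⁻ y in Ioc x (x + 1), (‖f y‖ₑ + ∫⁻ t in Ioc x (x + 1), ‖g t‖ₑ) :=
        setLIntegral_mono' measurableSet_Ioc hpt
    _ = (∫⁻ y in Ioc x (x + 1), ‖f y‖ₑ) + ∫⁻ t in Ioc x (x + 1), ‖g t‖ₑ := by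
        rw [lintegral_add_right _ measurable_const]; simp
    _ ≤ _ := add_le_add (key hfm) (key hg)

/-- The indicator makes the integrand locally integrable on all of `ℝ`, so Lebesgue differentiation
applies there; on `(0, ∞)` it changes nothing. -/
theorem hasACDeriv_intervalIntegral {g : ℝ → ℝ} (hg : MemLp g 2 halfLine) :
    HasACDeriv (fun x => ∫ t in (0 : ℝ)..x, (Ioi (0 : ℝ)).indicator g t) g := by
  have hl : LocallyIntegrable ((Ioi (0 : ℝ)).indicator g) := by
    have : MemLp ((Ioi (0 : ℝ)).indicator g) 2 volume :=
      (memLp_indicator_iff_restrict measurableSet_Ioi).2 hg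
    exact this.locallyIntegrable (by norm_num)
  refine ⟨fun b hb => ?_, ?_⟩
  · refine IntervalIntegrable.absolutelyContinuousOnInterval_intervalIntegral ?_ left_mem_uIcc
    exact intervalIntegrable_iff.2
      ((hl.integrableOn_isCompact isCompact_uIcc).mono_set uIoc_subset_uIcc)
  · refine (ae_restrict_iff' measurableSet_Ioi).2 ?_
    filter_upwards [LocallyIntegrable.ae_hasDerivAt_integral hl] with x hx h0
    simpa [indicator_of_mem h0] using hx 0

/-- A test function on `(0, ∞)` with vanishing integral is the derivative of a test function. -/
theorem exists_test_deriv_eq {ψ : ℝ → ℝ} (hψ : ContDiff ℝ ∞ ψ) (hc : HasCompactSupport ψ)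
    (hs : tsupport ψ ⊆ Ioi 0) (h0 : ∫ x, ψ x ∂halfLine = 0) :
    ∃ Ψ : ℝ → ℝ, ContDiff ℝ ∞ Ψ ∧ HasCompactSupport Ψ ∧ tsupport Ψ ⊆ Ioi 0 ∧ deriv Ψ = ψ := by
  obtain ⟨b, hb, hz⟩ := hc.exists_pos_forall_lt_eq_zero
  obtain ⟨a, ha, hza⟩ : ∃ a : ℝ, 0 < a ∧ ∀ x, x < a → ψ x = 0 := by
    rcases (tsupport ψ).eq_empty_or_nonempty with he | hne
    · exact ⟨1, one_pos, fun x _ => image_eq_zero_of_notMem_tsupport (by simp [he])⟩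
    · obtain ⟨a, ha, hmin⟩ := hc.isCompact.exists_isMinOn hne continuousOn_id
      exact ⟨a, hs ha, fun x hx => image_eq_zero_of_notMem_tsupport fun hm =>
        absurd (hmin hm) (not_le.2 hx)⟩
  have hi : ∀ x y, IntervalIntegrable ψ volume x y := fun x y =>
    hψ.continuous.intervalIntegrable x y
  have hd : ∀ x, HasDerivAt (fun x => ∫ t in (0 : ℝ)..x, ψ t) (ψ x) x := fun x =>
    intervalIntegral.integral_hasDerivAt_right (hi _ _)
      (hψ.continuous.stronglyMeasurableAtFilter _ _) hψ.continuous.continuousAt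
  have hde : deriv (fun x => ∫ t in (0 : ℝ)..x, ψ t) = ψ := funext fun x => (hd x).deriv
  -- The primitive vanishes left of `a` because `ψ` does, and right of `b` because the total
  -- integral of `ψ` is zero.
  have hsub : tsupport (fun x => ∫ t in (0 : ℝ)..x, ψ t) ⊆ Icc a b := by
    refine closure_minimal ?_ isClosed_Icc
    intro x hx
    by_contra hcon
    apply hx
    show ∫ t in (0 : ℝ)..x, ψ t = 0
    rcases lt_or_ge x a with hxa | hxa
    · refine (intervalIntegral.integral_congr (g := fun _ => (0 : ℝ)) fun t ht => ?_).trans (by simp)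
      exact hza t (ht.2.trans_lt (max_lt ha hxa))
    · have hbx : b < x := not_le.1 fun hxb => hcon ⟨hxa, hxb⟩
      rw [← integral_halfLine_eq_intervalIntegral (hb.le.trans hbx.le)
        fun t ht => hz t (hbx.le.trans ht.le), h0]
  refine ⟨_, ?_, ?_, hsub.trans fun x hx => ha.trans_le hx.1, hde⟩
  · rw [contDiff_infty_iff_deriv, hde]
    exact ⟨fun x => (hd x).differentiableAt, hψ⟩
  · exact isCompact_Icc.of_isClosed_subset (isClosed_tsupport _) hsub

theorem exists_test_integral_eq_one :
    ∃ ρ : ℝ → ℝ, ContDiff ℝ ∞ ρ ∧ HasCompactSupport ρ ∧ tsupport ρ ⊆ Ioi 0 ∧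
      ∫ x, ρ x ∂halfLine = 1 := by
  let B : ContDiffBump (2 : ℝ) := ⟨1 / 2, 1, by norm_num, by norm_num⟩
  have hsup : tsupport (B.normed volume) ⊆ Ioi 0 := by
    rw [B.tsupport_normed_eq]
    intro x hx
    have : |x - 2| ≤ 1 := hx
    have := (abs_le.1 this).1
    show 0 < x
    linarith
  refine ⟨B.normed volume, B.contDiff_normed, B.hasCompactSupport_normed, hsup, ?_⟩
  rw [setIntegral_eq_integral_of_forall_compl_eq_zero, B.integral_normed]
  exact fun x hx => image_eq_zero_of_notMem_tsupport fun h => hx (hsup h)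

theorem isWeakDeriv_one_iff {f g : ℝ → ℝ} : IsWeakDeriv 1 f g ↔
    ∀ φ : ℝ → ℝ, ContDiff ℝ ∞ φ → HasCompactSupport φ → tsupport φ ⊆ Ioi 0 →
      ∫ x, f x * deriv φ x ∂halfLine = -∫ x, g x * φ x ∂halfLine := by
  simp [IsWeakDeriv, iteratedDeriv_one]

/-- Needed beside `integrable_mul_test` because primitives of `L²` functions need not be in `L²`. -/
theorem locallyIntegrableOn_mul_test {f φ : ℝ → ℝ} (hf : LocallyIntegrableOn f (Ioi 0))
    (hφ : Continuous φ) (hc : HasCompactSupport φ) (hs : tsupport φ ⊆ Ioi 0) :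
    Integrable (fun x => f x * φ x) halfLine := by
  have h1 : IntegrableOn (fun x => f x * φ x) (tsupport φ) :=
    (hf.integrableOn_compact_subset hs hc).mul_continuousOn hφ.continuousOn hc
  have h2 : Integrable (fun x => f x * φ x) :=
    (integrableOn_iff_integrable_of_support_subset
      ((Function.support_mul_subset_right _ _).trans (subset_tsupport φ))).1 h1
  exact h2.restrict

/-- The lemma of du Bois-Reymond: a function on `(0, ∞)` with vanishing weak derivative is
constant. -/
theorem ae_eq_const_of_weakDeriv_zero {f : ℝ → ℝ} (hf : LocallyIntegrableOn f (Ioi 0))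
    (h : ∀ φ : ℝ → ℝ, ContDiff ℝ ∞ φ → HasCompactSupport φ → tsupport φ ⊆ Ioi 0 →
      ∫ x, f x * deriv φ x ∂halfLine = 0) :
    ∃ c : ℝ, f =ᵐ[halfLine] fun _ => c := by
  obtain ⟨ρ, hρ, hρc, hρs, hρ1⟩ := exists_test_integral_eq_one
  set c := ∫ x, f x * ρ x ∂halfLine with hcdef
  refine ⟨c, ?_⟩
  have hconst : LocallyIntegrableOn (fun _ : ℝ => c) (Ioi 0) :=
    (locallyIntegrable_const c).locallyIntegrableOn _
  have key := isOpen_Ioi.ae_eq_zero_of_integral_contDiff_smul_eq_zero (μ := (volume : Measure ℝ))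
    (U := Ioi (0 : ℝ)) (f := fun x => f x - c) (hf.sub hconst) (by
      intro φ hφ hφc hφs
      set s := ∫ x, φ x ∂halfLine with hsdef
      have hint : ∀ {k : ℝ → ℝ}, Continuous k → HasCompactSupport k → Integrable k halfLine :=
        fun hk hkc => (hk.integrable_of_hasCompactSupport hkc).restrict
      have hsρ : tsupport (fun x => s * ρ x) ⊆ Ioi 0 := by
        refine Subset.trans ?_ hρs
        exact closure_mono (Function.support_mul_subset_right _ _)
      have hsub : tsupport (fun x => φ x - s * ρ x) ⊆ Ioi 0 :=
        (tsupport_sub φ (fun x => s * ρ x)).trans (union_subset hφs hsρ)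
      have hsc : HasCompactSupport (fun x => s * ρ x) := hρc.mul_left
      -- Subtracting `s * ρ` removes the integral of `φ`, so the difference is the derivative of a
      -- test function and is annihilated by `f`. Thus `∫ f φ = s * c`, the integral of `c * φ`.
      obtain ⟨Ψ, h1, h2, h3, h4⟩ := exists_test_deriv_eq (ψ := fun x => φ x - s * ρ x)
        (hφ.sub (contDiff_const.mul hρ)) (hφc.sub hsc) hsub (by
          rw [integral_sub (hint hφ.continuous hφc)
            ((hint hρ.continuous hρc).const_mul s), integral_const_mul, hρ1, mul_one, sub_self])
      have h5 := h Ψ h1 h2 h3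
      rw [h4] at h5
      have i1 := locallyIntegrableOn_mul_test hf hφ.continuous hφc hφs
      have i2 := locallyIntegrableOn_mul_test hf hρ.continuous hρc hρs
      have h6 : ∫ x, f x * φ x ∂halfLine = s * c := by
        have e : ∀ x, f x * (φ x - s * ρ x) = f x * φ x - s * (f x * ρ x) := fun x => by ring
        simp only [e] at h5
        rw [integral_sub i1 (i2.const_mul s), integral_const_mul] at h5
        linarith
      have h7 : ∫ x, φ x • (f x - c) = ∫ x, φ x • (f x - c) ∂halfLine := by
        symm
        apply setIntegral_eq_integral_of_forall_compl_eq_zero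
        intro x hx
        rw [image_eq_zero_of_notMem_tsupport fun hh => hx (hφs hh), zero_smul]
      have e : ∀ x, φ x • (f x - c) = f x * φ x - c * φ x := fun x => by
        rw [smul_eq_mul]; ring
      rw [h7]
      simp only [e]
      rw [integral_sub i1 ((hint hφ.continuous hφc).const_mul c), integral_const_mul, h6]
      ring)
  refine (ae_restrict_iff' measurableSet_Ioi).2 ?_
  filter_upwards [key] with x hx h0 using sub_eq_zero.1 (hx h0)

/-- A square integrable function with square integrable weak derivative has an absolutely
continuous representative. -/
theorem IsWeakDeriv.exists_hasACDeriv {f g : ℝ → ℝ} (hf : MemLp f 2 halfLine)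
    (hg : MemLp g 2 halfLine) (h : IsWeakDeriv 1 f g) :
    ∃ F : ℝ → ℝ, F =ᵐ[halfLine] f ∧ HasACDeriv F g := by
  have hG := hasACDeriv_intervalIntegral hg
  set G := fun x => ∫ t in (0 : ℝ)..x, (Ioi (0 : ℝ)).indicator g t with hGdef
  have lf : LocallyIntegrableOn f (Ioi 0) :=
    locallyIntegrableOn_of_locallyIntegrable_restrict (hf.locallyIntegrable (by norm_num))
  have lG : LocallyIntegrableOn G (Ioi 0) :=
    (hG.continuousOn.mono Ioi_subset_Ici_self).locallyIntegrableOn measurableSet_Ioi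
  -- `f` and the primitive `G` have the same weak derivative, so they differ by a constant.
  obtain ⟨c, hc⟩ := ae_eq_const_of_weakDeriv_zero (f := fun x => f x - G x) (lf.sub lG) (by
    intro φ h1 h2 h3
    have hd : ContDiff ℝ ∞ (deriv φ) := (contDiff_infty_iff_deriv.1 h1).2
    have hds : tsupport (deriv φ) ⊆ Ioi 0 := tsupport_deriv_subset.trans h3
    simp only [sub_mul]
    rw [integral_sub (locallyIntegrableOn_mul_test lf hd.continuous h2.deriv hds)
      (locallyIntegrableOn_mul_test lG hd.continuous h2.deriv hds),
      isWeakDeriv_one_iff.1 h φ h1 h2 h3, hG.integral_mul_deriv_test h1 h2 h3, sub_self])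
  refine ⟨fun x => G x + c, ?_, ?_⟩
  · filter_upwards [hc] with x hx
    linarith
  · simpa using hG.add (hasACDeriv_const c)

/-- The Sobolev space records each derivative relative to `f` only. Testing the relation of order
`k` with `deriv φ` links consecutive derivatives. -/
theorem IsWeakDeriv.succ_of {k : ℕ} {f g g' : ℝ → ℝ} (h : IsWeakDeriv k f g)
    (h' : IsWeakDeriv (k + 1) f g') : IsWeakDeriv 1 g g' := by
  rw [isWeakDeriv_one_iff]
  intro φ h1 h2 h3
  have e1 := h (deriv φ) (contDiff_infty_iff_deriv.1 h1).2 h2.deriv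
    (tsupport_deriv_subset.trans h3)
  have e2 := h' φ h1 h2 h3
  rw [iteratedDeriv_succ', e1, pow_succ] at e2
  have hne : ((-1 : ℝ)) ^ k ≠ 0 := pow_ne_zero _ (by norm_num)
  apply mul_left_cancel₀ hne
  rw [e2]; ring

/-- Successive almost everywhere derivatives of absolutely continuous functions are weak
derivatives. -/
theorem isWeakDeriv_of_hasACDeriv {G : ℕ → ℝ → ℝ} {k : ℕ}
    (h : ∀ i < k, HasACDeriv (G i) (G (i + 1))) : IsWeakDeriv k (G 0) (G k) := by
  induction k generalizing G with
  | zero => intro φ _ _ _; simp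
  | succ k ih =>
    intro φ h1 h2 h3
    have e1 := ih (fun i hi => h i (by omega)) (deriv φ) (contDiff_infty_iff_deriv.1 h1).2 h2.deriv
      (tsupport_deriv_subset.trans h3)
    rw [iteratedDeriv_succ', e1, (h k (by omega)).integral_mul_deriv_test h1 h2 h3]
    ring

/-! ### Lipschitz families of functions -/

/-- A bounded family of square integrable functions depending Lipschitz continuously on a
parameter. -/
structure L2Lip {X : Type*} [PseudoMetricSpace X] (Φ : X → ℝ → ℝ) : Prop where
  memLp : ∀ u, MemLp (Φ u) 2 halfLine
  bdd : ∃ C : ℝ≥0, ∀ u, eLpNorm (Φ u) 2 halfLine ≤ C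
  lip : ∃ K : ℝ≥0, ∀ u v,
    eLpNorm (fun x => Φ u x - Φ v x) 2 halfLine ≤ ((K * nndist u v : ℝ≥0) : ENNReal)

/-- A bounded family of bounded measurable functions depending Lipschitz continuously on a
parameter, with respect to the supremum norm. -/
structure LinfLip {X : Type*} [PseudoMetricSpace X] (Φ : X → ℝ → ℝ) : Prop where
  meas : ∀ u, AEStronglyMeasurable (Φ u) halfLine
  bdd : ∃ C : ℝ≥0, ∀ u, ∀ x, 0 < x → ‖Φ u x‖₊ ≤ C
  lip : ∃ K : ℝ≥0, ∀ u v, ∀ x, 0 < x → ‖Φ u x - Φ v x‖₊ ≤ K * nndist u v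

/-- A family of functions which is bounded and Lipschitz continuous in `H^k(0, ∞)`. -/
def SobLip {X : Type*} [PseudoMetricSpace X] : ℕ → (X → ℝ → ℝ) → Prop
  | 0, Φ => L2Lip Φ
  | k + 1, Φ => L2Lip Φ ∧ ∃ Φ' : X → ℝ → ℝ, (∀ u, HasACDeriv (Φ u) (Φ' u)) ∧ SobLip k Φ'

theorem ae_halfLine_of_forall {p : ℝ → Prop} (h : ∀ x, 0 < x → p x) : ∀ᵐ x ∂halfLine, p x :=
  (ae_restrict_iff' measurableSet_Ioi).2 (.of_forall h)

section
variable {X : Type*} [PseudoMetricSpace X]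

theorem L2Lip.zero : L2Lip (fun (_ : X) (_ : ℝ) => (0 : ℝ)) where
  memLp _ := MemLp.zero'
  bdd := ⟨0, fun _ => by simp⟩
  lip := ⟨0, fun _ _ => by simp⟩

theorem L2Lip.add {Φ Ψ : X → ℝ → ℝ} (hΦ : L2Lip Φ) (hΨ : L2Lip Ψ) :
    L2Lip (fun u x => Φ u x + Ψ u x) := by
  obtain ⟨C, hC⟩ := hΦ.bdd
  obtain ⟨D, hD⟩ := hΨ.bdd
  obtain ⟨K, hK⟩ := hΦ.lip
  obtain ⟨L, hL⟩ := hΨ.lip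
  refine ⟨fun u => (hΦ.memLp u).add (hΨ.memLp u), ⟨C + D, fun u => ?_⟩, ⟨K + L, fun u v => ?_⟩⟩
  · push_cast
    exact (eLpNorm_add_le (hΦ.memLp u).1 (hΨ.memLp u).1 (by norm_num)).trans
      (add_le_add (hC u) (hD u))
  · have e : (fun x => Φ u x + Ψ u x - (Φ v x + Ψ v x))
        = (fun x => Φ u x - Φ v x) + fun x => Ψ u x - Ψ v x := by
      funext x; simp only [Pi.add_apply]; ring
    rw [e, add_mul, ENNReal.coe_add]
    exact (eLpNorm_add_le ((hΦ.memLp u).1.sub (hΦ.memLp v).1) ((hΨ.memLp u).1.sub (hΨ.memLp v).1)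
      (by norm_num)).trans (add_le_add (hK u v) (hL u v))

/-- Split the difference as `Φ u (Ψ u - Ψ v) + (Φ u - Φ v) Ψ v`; this is where uniform bounds are
needed along with Lipschitz constants. -/
theorem L2Lip.mul {Φ Ψ : X → ℝ → ℝ} (hΦ : L2Lip Φ) (hΨ : LinfLip Ψ) :
    L2Lip (fun u x => Φ u x * Ψ u x) := by
  obtain ⟨C, hC⟩ := hΦ.bdd
  obtain ⟨D, hD⟩ := hΨ.bdd
  obtain ⟨K, hK⟩ := hΦ.lip
  obtain ⟨L, hL⟩ := hΨ.lip
  have key : ∀ {f g : ℝ → ℝ} {c M : ℝ≥0}, (∀ x, 0 < x → ‖g x‖₊ ≤ c) →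
      eLpNorm f 2 halfLine ≤ M → eLpNorm (fun x => f x * g x) 2 halfLine ≤ ((c * M : ℝ≥0) : ENNReal) := by
    intro f g c M hg hf
    refine (eLpNorm_le_nnreal_smul_eLpNorm_of_ae_le_mul (g := f) (c := c)
      (ae_halfLine_of_forall fun x hx => ?_) 2).trans ?_
    · rw [nnnorm_mul, mul_comm]
      gcongr
      exact hg x hx
    · rw [ENNReal.smul_def, smul_eq_mul, ENNReal.coe_mul]
      gcongr
  refine ⟨fun u => ⟨(hΦ.memLp u).1.mul (hΨ.meas u), ?_⟩, ⟨D * C, fun u => key (hD u) (hC u)⟩,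
    ⟨L * C + D * K, fun u v => ?_⟩⟩
  · exact (key (hD u) (hC u)).trans_lt ENNReal.coe_lt_top
  · have e : (fun x => Φ u x * Ψ u x - Φ v x * Ψ v x)
        = (fun x => Φ u x * (Ψ u x - Ψ v x)) + fun x => (Φ u x - Φ v x) * Ψ v x := by
      funext x; simp only [Pi.add_apply]; ring
    have e' : (L * C + D * K) * nndist u v = L * nndist u v * C + D * (K * nndist u v) := by ring
    rw [e, e', ENNReal.coe_add]
    exact (eLpNorm_add_le ((hΦ.memLp u).1.mul ((hΨ.meas u).sub (hΨ.meas v)))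
      (((hΦ.memLp u).1.sub (hΦ.memLp v).1).mul (hΨ.meas v)) (by norm_num)).trans
      (add_le_add (key (hL u v) (hC u)) (key (hD v) (hK u v)))

theorem SobLip.l2Lip {k : ℕ} {Φ : X → ℝ → ℝ} (h : SobLip k Φ) : L2Lip Φ := by
  cases k with
  | zero => exact h
  | succ k => exact h.1

theorem SobLip.of_succ {k : ℕ} {Φ : X → ℝ → ℝ} (h : SobLip (k + 1) Φ) : SobLip k Φ := by
  induction k generalizing Φ with
  | zero => exact h.1
  | succ k ih => exact ⟨h.1, h.2.choose, h.2.choose_spec.1, ih h.2.choose_spec.2⟩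

theorem SobLip.of_le {k n : ℕ} {Φ : X → ℝ → ℝ} (h : SobLip n Φ) (hkn : k ≤ n) : SobLip k Φ := by
  induction n, hkn using Nat.le_induction with
  | base => exact h
  | succ n _ ih => exact ih h.of_succ

theorem SobLip.continuousOn {k : ℕ} {Φ : X → ℝ → ℝ} (h : SobLip (k + 1) Φ) (u : X) :
    ContinuousOn (Φ u) (Ici 0) :=
  (h.2.choose_spec.1 u).continuousOn

/-- The Sobolev inequality, applied to `Φ u` for the bound and to `Φ u - Φ v` for the Lipschitz
constant. -/
theorem SobLip.linfLip {k : ℕ} {Φ : X → ℝ → ℝ} (h : SobLip (k + 1) Φ) : LinfLip Φ := by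
  obtain ⟨h0, Φ', hd, h1⟩ := h
  have h1 := h1.l2Lip
  obtain ⟨C, hC⟩ := h0.bdd
  obtain ⟨D, hD⟩ := h1.bdd
  obtain ⟨K, hK⟩ := h0.lip
  obtain ⟨L, hL⟩ := h1.lip
  refine ⟨fun u => (h0.memLp u).1, ⟨C + D, fun u x hx => ?_⟩, ⟨K + L, fun u v x hx => ?_⟩⟩
  · have := ((hd u).enorm_le (h1.memLp u).1 hx).trans (add_le_add (hC u) (hD u))
    rw [enorm_eq_nnnorm] at this
    exact_mod_cast this
  · have := (((hd u).sub (hd v)).enorm_le ((h1.memLp u).1.sub (h1.memLp v).1) hx).trans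
      (add_le_add (hK u v) (hL u v))
    rw [enorm_eq_nnnorm, ← ENNReal.coe_add, ← add_mul] at this
    exact_mod_cast this

theorem SobLip.zero (k : ℕ) : SobLip k (fun (_ : X) (_ : ℝ) => (0 : ℝ)) := by
  induction k with
  | zero => exact L2Lip.zero
  | succ k ih => exact ⟨L2Lip.zero, _, fun _ => hasACDeriv_const 0, ih⟩

theorem SobLip.add {k : ℕ} {Φ Ψ : X → ℝ → ℝ} (hΦ : SobLip k Φ) (hΨ : SobLip k Ψ) :
    SobLip k (fun u x => Φ u x + Ψ u x) := by
  induction k generalizing Φ Ψ with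
  | zero => exact L2Lip.add hΦ hΨ
  | succ k ih =>
    obtain ⟨h0, Φ', hd, h1⟩ := hΦ
    obtain ⟨g0, Ψ', gd, g1⟩ := hΨ
    exact ⟨h0.add g0, _, fun u => (hd u).add (gd u), ih h1 g1⟩

theorem SobLip.sum {k : ℕ} {ι : Type*} (s : Finset ι) {Φ : ι → X → ℝ → ℝ}
    (h : ∀ i ∈ s, SobLip k (Φ i)) : SobLip k (fun u x => ∑ i ∈ s, Φ i u x) := by
  classical
  induction s using Finset.induction_on with
  | empty => simpa using SobLip.zero k
  | insert i s hi ih =>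
    simp only [Finset.sum_insert hi]
    exact (h i (by simp)).add (ih fun j hj => h j (by simp [hj]))

/-- The orders are asymmetric so that the base case is `L² · L^∞`. In the Leibniz rule both `Φ' Ψ`
and `Φ Ψ'` again pair a factor of order `k` with one of order `k + 1`. -/
theorem SobLip.mul {k : ℕ} {Φ Ψ : X → ℝ → ℝ} (hΦ : SobLip k Φ) (hΨ : SobLip (k + 1) Ψ) :
    SobLip k (fun u x => Φ u x * Ψ u x) := by
  induction k generalizing Φ Ψ with
  | zero => exact L2Lip.mul hΦ hΨ.linfLip
  | succ k ih =>
    have hΦ1 := hΦ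
    have hΨ1 := hΨ.of_succ
    have hinf := hΨ.linfLip
    obtain ⟨h0, Φ', hd, h1⟩ := hΦ
    obtain ⟨g0, Ψ', gd, g1⟩ := hΨ
    refine ⟨h0.mul hinf, _, fun u => (hd u).mul (gd u), (ih h1 hΨ1).add ?_⟩
    simpa only [mul_comm] using ih g1.of_succ hΦ1

/-- Unrolls the recursion into the list of successive derivatives, the form in which elements of
`SobolevSpace` are stored. -/
theorem SobLip.exists_seq {k : ℕ} {Φ : X → ℝ → ℝ} (h : SobLip k Φ) :
    ∃ G : ℕ → X → ℝ → ℝ, G 0 = Φ ∧ (∀ i ≤ k, L2Lip (G i)) ∧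
      ∀ i < k, ∀ u, HasACDeriv (G i u) (G (i + 1) u) := by
  induction k generalizing Φ with
  | zero => exact ⟨fun _ => Φ, rfl, fun _ _ => h, by simp⟩
  | succ k ih =>
    obtain ⟨h0, Φ', hd, h1⟩ := h
    obtain ⟨G, hG0, hG1, hG2⟩ := ih h1
    refine ⟨fun i => Nat.casesOn i Φ G, rfl, ?_, ?_⟩
    · rintro (_ | i) hi
      · exact h0
      · exact hG1 i (by omega)
    · rintro (_ | i) hi u
      · simpa [hG0] using hd u
      · exact hG2 i (by omega) u

theorem sobLip_of_seq {k : ℕ} {G : ℕ → X → ℝ → ℝ} (h1 : ∀ i ≤ k, L2Lip (G i))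
    (h2 : ∀ i < k, ∀ u, HasACDeriv (G i u) (G (i + 1) u)) : SobLip k (G 0) := by
  induction k generalizing G with
  | zero => exact h1 0 le_rfl
  | succ k ih =>
    exact ⟨h1 0 (by omega), G 1, h2 0 (by omega),
      ih (G := fun i => G (i + 1)) (fun i hi => h1 _ (by omega)) fun i hi => h2 _ (by omega)⟩

end

/-! ### The Nemytskii operator on families -/

section
variable {X : Type*} [PseudoMetricSpace X] {d : ℕ}

/-- The `ℝ^d`-valued function with given components. -/
noncomputable def vecFun (f : Fin d → ℝ → ℝ) (x : ℝ) : EuclideanSpace ℝ (Fin d) :=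
  WithLp.toLp 2 fun j => f j x

theorem EuclideanSpace.nnnorm_le_sum (y : EuclideanSpace ℝ (Fin d)) : ‖y‖₊ ≤ ∑ j, ‖y j‖₊ := by
  have h : y = ∑ j, EuclideanSpace.single j (y j) := by
    ext i
    simp [Finset.sum_apply, Pi.single_apply]
  calc ‖y‖₊ = ‖∑ j, EuclideanSpace.single j (y j)‖₊ := by rw [← h]
    _ ≤ ∑ j, ‖EuclideanSpace.single j (y j)‖₊ := nnnorm_sum_le _ _
    _ = _ := by simp

theorem continuousOn_vecFun {f : Fin d → ℝ → ℝ} {s : Set ℝ} (h : ∀ j, ContinuousOn (f j) s) :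
    ContinuousOn (vecFun f) s := by
  unfold vecFun
  fun_prop

theorem LinfLip.exists_bound {U : Fin d → X → ℝ → ℝ} (h : ∀ j, LinfLip (U j)) :
    ∃ C : ℝ≥0, ∀ u x, 0 < x → ‖vecFun (fun j => U j u) x‖₊ ≤ C := by
  choose C hC using fun j => (h j).bdd
  refine ⟨∑ j, C j, fun u x hx => (EuclideanSpace.nnnorm_le_sum _).trans ?_⟩
  exact Finset.sum_le_sum fun j _ => hC j u x hx

theorem nnnorm_vecFun_sub_le (f g : Fin d → ℝ → ℝ) (x : ℝ) :
    ‖vecFun f x - vecFun g x‖₊ ≤ ∑ j, ‖f j x - g j x‖₊ :=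
  EuclideanSpace.nnnorm_le_sum _

/-- `ν(x, ·)` is locally Lipschitz continuous uniformly in `x ≥ 0`. -/
def UnifLocLip (ν : ℝ × EuclideanSpace ℝ (Fin d) → ℝ) : Prop :=
  ∀ r : ℝ, 0 ≤ r → ∃ L : ℝ≥0, ∀ x : ℝ, 0 ≤ x → ∀ y z, ‖y‖ ≤ r → ‖z‖ ≤ r →
    ‖ν (x, y) - ν (x, z)‖₊ ≤ L * ‖y - z‖₊

/-- `sup_{x > 0} |ν(x, ·)|` is locally bounded. -/
def UnifLocBdd (ν : ℝ × EuclideanSpace ℝ (Fin d) → ℝ) : Prop :=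
  ∀ r : ℝ, ∃ C : ℝ≥0, ∀ y, ‖y‖ ≤ r → ∀ x : ℝ, 0 < x → ‖ν (x, y)‖₊ ≤ C

/-- The growth condition `|ν(x, y)| ≤ a(x) + b(y) |y|` with `a` square integrable and `b` locally
bounded. -/
def L2Growth (ν : ℝ × EuclideanSpace ℝ (Fin d) → ℝ) : Prop :=
  ∃ a : ℝ → ℝ, MemLp a 2 halfLine ∧ ∀ r : ℝ, ∃ C : ℝ≥0, ∀ y, ‖y‖ ≤ r → ∀ x : ℝ, 0 < x →
    |ν (x, y)| ≤ a x + C * ‖y‖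

theorem continuousOn_nemytskii {ν : ℝ × EuclideanSpace ℝ (Fin d) → ℝ}
    (hν : ContinuousOn ν (halfSpace d)) {f : Fin d → ℝ → ℝ} (h : ∀ j, ContinuousOn (f j) (Ici 0)) :
    ContinuousOn (nemytskii ν (vecFun f)) (Ici 0) :=
  hν.comp (continuousOn_id.prodMk (continuousOn_vecFun h)) fun _ hx => ⟨hx, mem_univ _⟩

theorem LinfLip.nemytskii {ν : ℝ × EuclideanSpace ℝ (Fin d) → ℝ}
    (hc : ContinuousOn ν (halfSpace d)) (hl : UnifLocLip ν) (hb : UnifLocBdd ν)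
    {U : Fin d → X → ℝ → ℝ} (hU : ∀ j, LinfLip (U j)) (hUc : ∀ j u, ContinuousOn (U j u) (Ici 0)) :
    LinfLip (fun u => nemytskii ν (vecFun fun j => U j u)) := by
  obtain ⟨r, hr⟩ := LinfLip.exists_bound hU
  obtain ⟨C, hC⟩ := hb r
  obtain ⟨L, hL⟩ := hl r r.2
  choose K hK using fun j => (hU j).lip
  refine ⟨fun u => (continuousOn_nemytskii hc fun j => hUc j u).aestronglyMeasurable_halfLine,
    ⟨C, fun u x hx => hC _ (hr u x hx) x hx⟩, ⟨L * ∑ j, K j, fun u v x hx => ?_⟩⟩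
  refine (hL x hx.le _ _ (hr u x hx) (hr v x hx)).trans ?_
  rw [mul_assoc, Finset.sum_mul]
  gcongr
  refine (nnnorm_vecFun_sub_le _ _ x).trans ?_
  gcongr with j
  exact hK j u v x hx

theorem eLpNorm_le_sum_of_nnnorm_le {f : ℝ → ℝ} {g : Fin d → ℝ → ℝ} {L : ℝ≥0} {M : Fin d → ℝ≥0}
    (h : ∀ x, 0 < x → ‖f x‖₊ ≤ L * ∑ j, ‖g j x‖₊) (hg : ∀ j, AEStronglyMeasurable (g j) halfLine)
    (hM : ∀ j, eLpNorm (g j) 2 halfLine ≤ M j) :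
    eLpNorm f 2 halfLine ≤ ((L * ∑ j, M j : ℝ≥0) : ENNReal) := by
  refine (eLpNorm_le_nnreal_smul_eLpNorm_of_ae_le_mul (g := fun x => ∑ j, ‖g j x‖) (c := L)
    (ae_halfLine_of_forall fun x hx => ?_) 2).trans ?_
  · refine (h x hx).trans (le_of_eq ?_)
    congr 1
    ext
    push_cast
    rw [Real.norm_of_nonneg (by positivity)]
  · rw [ENNReal.smul_def, smul_eq_mul, ENNReal.coe_mul]
    gcongr
    have e : (fun x => ∑ j, ‖g j x‖) = ∑ j, fun x => ‖g j x‖ := by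
      funext x; simp
    rw [e]
    refine (eLpNorm_sum_le (fun j _ => (hg j).norm) (by norm_num)).trans ?_
    push_cast
    gcongr with j
    rw [eLpNorm_norm]
    exact hM j

/-- The sup bound confines all values to one ball of radius `r`, which fixes the growth and
Lipschitz constants of `ν`. The `L²` estimates on the components then pass to the composition. -/
theorem L2Lip.nemytskii {ν : ℝ × EuclideanSpace ℝ (Fin d) → ℝ}
    (hc : ContinuousOn ν (halfSpace d)) (hl : UnifLocLip ν) (hb : L2Growth ν)
    {U : Fin d → X → ℝ → ℝ} (hU : ∀ j, LinfLip (U j)) (hU2 : ∀ j, L2Lip (U j))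
    (hUc : ∀ j u, ContinuousOn (U j u) (Ici 0)) :
    L2Lip (fun u => nemytskii ν (vecFun fun j => U j u)) := by
  obtain ⟨r, hr⟩ := LinfLip.exists_bound hU
  obtain ⟨a, ha, hb⟩ := hb
  obtain ⟨C, hC⟩ := hb r
  obtain ⟨L, hL⟩ := hl r r.2
  choose K hK using fun j => (hU2 j).lip
  choose D hD using fun j => (hU2 j).bdd
  have hmeas := fun u => (continuousOn_nemytskii hc fun j => hUc j u).aestronglyMeasurable_halfLine
  have hbd : ∀ u, eLpNorm (_root_.nemytskii ν (vecFun fun j => U j u)) 2 halfLine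
      ≤ ((eLpNorm a 2 halfLine).toNNReal + C * ∑ j, D j : ℝ≥0) := by
    intro u
    have h1 : eLpNorm (fun x => (C : ℝ) * ∑ j, ‖U j u x‖) 2 halfLine ≤ ((C * ∑ j, D j : ℝ≥0) : ENNReal) :=
      eLpNorm_le_sum_of_nnnorm_le (g := fun j => U j u)
        (fun x _ => by
          rw [nnnorm_mul, NNReal.nnnorm_eq]
          gcongr
          exact (nnnorm_sum_le _ _).trans (by simp)) (fun j => ((hU2 j).memLp u).1) fun j => hD j u
    have h2 : eLpNorm (_root_.nemytskii ν (vecFun fun j => U j u)) 2 halfLine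
        ≤ eLpNorm (a + fun x => (C : ℝ) * ∑ j, ‖U j u x‖) 2 halfLine := by
      refine eLpNorm_mono_ae_real (ae_halfLine_of_forall fun x hx => ?_)
      refine (hC _ (hr u x hx) x hx).trans ?_
      simp only [Pi.add_apply]
      gcongr
      exact (NNReal.coe_le_coe.2 (EuclideanSpace.nnnorm_le_sum (vecFun (fun j => U j u) x))).trans_eq
        (by simp [vecFun])
    refine h2.trans ((eLpNorm_add_le ha.1 ?_ (by norm_num)).trans ?_)
    · refine AEStronglyMeasurable.const_mul ?_ _
      exact Finset.aestronglyMeasurable_fun_sum _ fun j _ => ((hU2 j).memLp u).1.norm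
    · rw [ENNReal.coe_add, ENNReal.coe_toNNReal ha.2.ne]
      gcongr
  refine ⟨fun u => ⟨hmeas u, (hbd u).trans_lt ENNReal.coe_lt_top⟩, ⟨_, hbd⟩,
    ⟨L * ∑ j, K j, fun u v => ?_⟩⟩
  rw [mul_assoc, Finset.sum_mul]
  refine eLpNorm_le_sum_of_nnnorm_le (g := fun j x => U j u x - U j v x) (fun x hx => ?_)
    (fun j => ((hU2 j).memLp u).1.sub ((hU2 j).memLp v).1) fun j => hK j u v
  refine (hL x hx.le _ _ (hr u x hx) (hr v x hx)).trans ?_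
  gcongr
  exact nnnorm_vecFun_sub_le _ _ x

/-- Over any finite disjoint family of intervals, the total oscillation of `g` is at most `K` times
the sum of those of `f` and the `F j`, each of which tends to zero with the total length. -/
theorem AbsolutelyContinuousOnInterval.of_dist_le_sum {Y : Type*} [PseudoMetricSpace Y]
    {f : ℝ → ℝ} {a b : ℝ} {F : Fin d → ℝ → ℝ} {g : ℝ → Y} {K : ℝ≥0}
    (hF : ∀ j, AbsolutelyContinuousOnInterval (F j) a b)
    (hf : AbsolutelyContinuousOnInterval f a b)
    (h : ∀ x ∈ uIcc a b, ∀ y ∈ uIcc a b,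
      dist (g x) (g y) ≤ K * (dist (f x) (f y) + ∑ j, dist (F j x) (F j y))) :
    AbsolutelyContinuousOnInterval g a b := by
  unfold AbsolutelyContinuousOnInterval at hF hf ⊢
  have key := (hf.add (tendsto_finsetSum Finset.univ fun j _ => hF j)).const_mul (K : ℝ)
  simp only [Finset.sum_const_zero, add_zero, mul_zero] at key
  refine squeeze_zero' (.of_forall fun E => Finset.sum_nonneg fun i _ => dist_nonneg) ?_ key
  filter_upwards [mem_inf_of_right (mem_principal_self _)] with E hE
  rw [Finset.sum_comm, ← Finset.sum_add_distrib, Finset.mul_sum]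
  exact Finset.sum_le_sum fun i hi => h _ (hE.1 i hi).1 _ (hE.1 i hi).2

theorem uniqueDiffOn_halfSpace : UniqueDiffOn ℝ (halfSpace d) :=
  (uniqueDiffOn_Ici 0).prod uniqueDiffOn_univ

theorem halfSpace_mem_nhds {x : ℝ} (hx : 0 < x) (y : EuclideanSpace ℝ (Fin d)) :
    halfSpace d ∈ nhds (x, y) :=
  prod_mem_nhds (Ici_mem_nhds hx) univ_mem

theorem coordDir_decomp (s : ℝ) (y : EuclideanSpace ℝ (Fin d)) :
    (s, y) = s • coordDir d 0 + ∑ j : Fin d, y j • coordDir d j.succ := by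
  ext i
  · simp [coordDir, Prod.fst_sum]
  · simp [coordDir, Prod.snd_sum, Finset.sum_apply, Pi.single_apply]

/-- The chain rule for `x ↦ ν(x, f(x))` with `ν` of class `C¹` and `f` absolutely continuous. -/
theorem HasACDeriv.nemytskii {ν : ℝ × EuclideanSpace ℝ (Fin d) → ℝ}
    (hν : ContDiffOn ℝ 1 ν (halfSpace d)) {f f' : Fin d → ℝ → ℝ}
    (h : ∀ j, HasACDeriv (f j) (f' j)) :
    HasACDeriv (nemytskii ν (vecFun f)) (fun x =>
      fderivWithin ℝ ν (halfSpace d) (x, vecFun f x) (coordDir d 0) +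
      ∑ j, fderivWithin ℝ ν (halfSpace d) (x, vecFun f x) (coordDir d j.succ) * f' j x) := by
  constructor
  · intro b hb
    have hc : ContinuousOn (vecFun f) (Icc 0 b) :=
      (continuousOn_vecFun fun j => (h j).continuousOn).mono Icc_subset_Ici_self
    obtain ⟨R, hR⟩ := isCompact_Icc.exists_bound_of_continuousOn hc
    -- On `[0, b]` the curve stays in a compact convex set, where a `C¹` function is Lipschitz.
    obtain ⟨K, hK⟩ := ContDiffOn.exists_lipschitzOnWith
      (s := Icc (0 : ℝ) b ×ˢ Metric.closedBall (0 : EuclideanSpace ℝ (Fin d)) R)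
      (hν.mono (prod_mono Icc_subset_Ici_self (subset_univ _))) one_ne_zero
      ((convex_Icc 0 b).prod (convex_closedBall 0 R)) (isCompact_Icc.prod (isCompact_closedBall 0 R))
    have hid : AbsolutelyContinuousOnInterval (fun x : ℝ => x) 0 b :=
      (contDiffOn_id (n := 1)).absolutelyContinuousOnInterval
    refine AbsolutelyContinuousOnInterval.of_dist_le_sum (K := K)
      (fun j => (h j).1 b hb) hid ?_
    rw [uIcc_of_le hb.le]
    intro x hx y hy
    have hmem : ∀ z ∈ Icc (0 : ℝ) b, (z, vecFun f z) ∈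
        Icc (0 : ℝ) b ×ˢ Metric.closedBall (0 : EuclideanSpace ℝ (Fin d)) R :=
      fun z hz => ⟨hz, by simpa using hR z hz⟩
    refine (hK.dist_le_mul _ (hmem x hx) _ (hmem y hy)).trans ?_
    gcongr
    rw [Prod.dist_eq]
    refine max_le (le_add_of_nonneg_right (by positivity)) ?_
    refine le_add_of_nonneg_of_le dist_nonneg ?_
    rw [dist_eq_norm]
    simp only [dist_eq_norm]
    have e : vecFun f x - vecFun f y = vecFun f x - vecFun (fun j _ => f j y) x := rfl
    rw [e]
    exact (NNReal.coe_le_coe.2 (nnnorm_vecFun_sub_le f (fun j _ => f j y) x)).trans_eq (by simp)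
  · have hae : ∀ᵐ x ∂halfLine, ∀ j, HasDerivAt (f j) (f' j x) x := ae_all_iff.2 fun j => (h j).2
    filter_upwards [hae, ae_halfLine_of_forall fun x hx => hx] with x hx hx0
    have hd : HasDerivAt (fun t => (t, vecFun f t)) (1, vecFun f' x) x := by
      refine (hasDerivAt_id x).prodMk ?_
      unfold vecFun
      exact (PiLp.continuousLinearEquiv 2 ℝ (fun _ : Fin d => ℝ)).symm.toContinuousLinearMap
        |>.hasFDerivAt.comp_hasDerivAt x (hasDerivAt_pi.2 hx)
    have hnhds := halfSpace_mem_nhds hx0 (vecFun f x)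
    -- For `x > 0` the point is interior, so the derivative within the half-space is the full one.
    have hF : HasFDerivAt ν (fderivWithin ℝ ν (halfSpace d) (x, vecFun f x)) (x, vecFun f x) :=
      ((hν.differentiableOn one_ne_zero) _ (mem_of_mem_nhds hnhds)).hasFDerivWithinAt.hasFDerivAt
        hnhds
    have := hF.comp_hasDerivAt x hd
    rw [coordDir_decomp 1 (vecFun f' x)] at this
    simp only [map_add, map_smul, map_sum, one_smul, smul_eq_mul] at this
    simpa only [vecFun, mul_comm] using! this

end

/-! ### Iterated partial derivatives -/

section
variable {d : ℕ} {m : ℕ} {μ : ℝ × EuclideanSpace ℝ (Fin d) → ℝ}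

/-- The iterated partial derivative of `μ` on the closed half-space along a word of coordinate
directions. -/
noncomputable def wordDeriv (μ : ℝ × EuclideanSpace ℝ (Fin d) → ℝ) :
    List (Fin (d + 1)) → ℝ × EuclideanSpace ℝ (Fin d) → ℝ
  | [] => μ
  | i :: w => fun z => fderivWithin ℝ (wordDeriv μ w) (halfSpace d) z (coordDir d i)

theorem contDiffOn_wordDeriv (hμ : ContDiffOn ℝ m μ (halfSpace d)) (w : List (Fin (d + 1))) {k : ℕ}
    (hk : w.length + k ≤ m) : ContDiffOn ℝ k (wordDeriv μ w) (halfSpace d) := by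
  induction w generalizing k with
  | nil => exact hμ.of_le (by exact_mod_cast (by simpa using hk))
  | cons i w ih =>
    rw [List.length_cons] at hk
    have := (ih (k := k + 1) (by omega)).fderivWithin uniqueDiffOn_halfSpace (m := k)
      (by norm_cast)
    exact this.clm_apply contDiffOn_const

theorem halfSpace_subset_closure_interior : halfSpace d ⊆ closure (interior (halfSpace d)) := by
  unfold halfSpace
  rw [interior_prod_eq, interior_Ici, interior_univ, closure_prod_eq, closure_Ioi, closure_univ]

/-- Both sides evaluate the second derivative of `wordDeriv μ w` on the same two directions. Its
symmetry extends to boundary points because they are limits of interior points. -/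
theorem wordDeriv_swap (hμ : ContDiffOn ℝ m μ (halfSpace d)) (w : List (Fin (d + 1)))
    (i j : Fin (d + 1)) (hw : w.length + 2 ≤ m) {z : ℝ × EuclideanSpace ℝ (Fin d)}
    (hz : z ∈ halfSpace d) : wordDeriv μ (i :: j :: w) z = wordDeriv μ (j :: i :: w) z := by
  have h2 : ContDiffOn ℝ 2 (wordDeriv μ w) (halfSpace d) := contDiffOn_wordDeriv hμ w hw
  have hd : DifferentiableWithinAt ℝ (fderivWithin ℝ (wordDeriv μ w) (halfSpace d))
      (halfSpace d) z :=
    ((h2.fderivWithin uniqueDiffOn_halfSpace (m := 1) (by norm_num)).differentiableOn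
      one_ne_zero) z hz
  have e : ∀ i j : Fin (d + 1), wordDeriv μ (i :: j :: w) z
      = fderivWithin ℝ (fderivWithin ℝ (wordDeriv μ w) (halfSpace d)) (halfSpace d) z
        (coordDir d i) (coordDir d j) := by
    intro i j
    simp only [wordDeriv]
    rw [fderivWithin_clm_apply (uniqueDiffOn_halfSpace z hz) hd (differentiableWithinAt_const _)]
    simp
  rw [e, e]
  exact (h2 z hz).isSymmSndFDerivWithinAt (by simp) uniqueDiffOn_halfSpace
    (halfSpace_subset_closure_interior hz) hz _ _

theorem wordDeriv_perm (hμ : ContDiffOn ℝ m μ (halfSpace d)) {w w' : List (Fin (d + 1))}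
    (h : w.Perm w') (hw : w.length ≤ m) :
    EqOn (wordDeriv μ w) (wordDeriv μ w') (halfSpace d) := by
  induction h with
  | nil => exact fun _ _ => rfl
  | cons i h ih =>
    intro z hz
    rw [List.length_cons] at hw
    have hi := ih (by omega)
    simp only [wordDeriv]
    rw [fderivWithin_congr hi (hi hz)]
  | swap i j w => exact fun z hz => wordDeriv_swap hμ w j i hw hz
  | trans h1 _ ih1 ih2 => exact (ih1 hw).trans (ih2 (by rwa [← h1.length_eq]))

/-- The head of a word is the outermost differentiation, which matches the left recursion of
`iteratedFDerivWithin`. -/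
theorem iteratedFDerivWithin_eq_wordDeriv (hμ : ContDiffOn ℝ m μ (halfSpace d)) {n : ℕ}
    (hn : n ≤ m) (v : Fin n → Fin (d + 1)) {z : ℝ × EuclideanSpace ℝ (Fin d)}
    (hz : z ∈ halfSpace d) :
    iteratedFDerivWithin ℝ n μ (halfSpace d) z (fun p => coordDir d (v p))
      = wordDeriv μ (List.ofFn v) z := by
  induction n generalizing z with
  | zero => simp [wordDeriv]
  | succ n ih =>
    rw [iteratedFDerivWithin_succ_apply_left, List.ofFn_succ]
    simp only [wordDeriv]
    have hi : EqOn (wordDeriv μ (List.ofFn fun p => v p.succ))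
        (fun z => iteratedFDerivWithin ℝ n μ (halfSpace d) z fun p => coordDir d (v p.succ))
        (halfSpace d) := fun z hz => (ih (by omega) _ hz).symm
    rw [fderivWithin_congr hi (hi hz)]
    have hd : DifferentiableWithinAt ℝ (iteratedFDerivWithin ℝ n μ (halfSpace d)) (halfSpace d) z :=
      hμ.differentiableOn_iteratedFDerivWithin (by exact_mod_cast hn) uniqueDiffOn_halfSpace z hz
    rw [fderivWithin_continuousMultilinear_apply_const_apply (uniqueDiffOn_halfSpace z hz) hd]
    rfl

theorem count_ofFn_finSigma {n : ℕ} (α : Fin n → ℕ) (i : Fin n) :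
    (List.ofFn fun p => (finSigmaFinEquiv (n := α) |>.symm p).1).count i = α i := by
  rw [← Multiset.coe_count, ← Fin.univ_val_map, Multiset.count_map, ← Finset.filter_val,
    Finset.card_val, Finset.card_filter,
    Equiv.sum_comp finSigmaFinEquiv.symm (fun s => if i = s.1 then 1 else 0), Fintype.sum_sigma]
  simp [apply_ite Finset.card]

theorem sum_count_eq_length {n : ℕ} (w : List (Fin n)) : ∑ i, w.count i = w.length := by
  simpa using (List.perm_iff_count.2 fun i => count_ofFn_finSigma (fun i => w.count i) i).length_eq

/-- The tuple in `multiDeriv` lists each direction as often as `w` does, so it is a permutation of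
`w`, and partial derivatives commute. -/
theorem multiDeriv_eq_wordDeriv (hμ : ContDiffOn ℝ m μ (halfSpace d)) {w : List (Fin (d + 1))}
    (hw : w.length ≤ m) {x : ℝ} (hx : 0 ≤ x) (y : EuclideanSpace ℝ (Fin d)) :
    multiDeriv (fun i => w.count i) μ (x, y) = wordDeriv μ w (x, y) := by
  have hz : (x, y) ∈ halfSpace d := ⟨hx, mem_univ _⟩
  have hp : (List.ofFn fun p => (finSigmaFinEquiv (n := fun i => w.count i) |>.symm p).1).Perm w :=
    List.perm_iff_count.2 fun i => count_ofFn_finSigma _ i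
  unfold multiDeriv
  rw [iteratedFDerivWithin_eq_wordDeriv hμ ((sum_count_eq_length w).trans_le hw) _ hz]
  exact wordDeriv_perm hμ hp (hp.length_eq.trans_le hw) hz

theorem LipschitzAssumption.unifLocLip (h : LipschitzAssumption m μ) {w : List (Fin (d + 1))}
    (hw : w.length ≤ m) : UnifLocLip (wordDeriv μ w) := by
  intro r hr
  obtain ⟨L, hL0, hL⟩ := h.lipschitz r hr
  refine ⟨⟨L, hL0⟩, fun x hx y z hy hz => ?_⟩
  have := hL (fun i => w.count i) ((sum_count_eq_length w).trans_le hw) x hx y z hy hz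
  rw [multiDeriv_eq_wordDeriv h.contDiffOn hw hx _,
    multiDeriv_eq_wordDeriv h.contDiffOn hw hx _] at this
  exact this

theorem GrowthAssumption.unifLocBdd (h : GrowthAssumption m μ) {w : List (Fin (d + 1))}
    (hw : w.length ≤ m) (hne : ∃ i ∈ w, i ≠ 0) : UnifLocBdd (wordDeriv μ w) := by
  intro r
  -- A letter other than `0` in the word is exactly the condition `α₁ ≠ |α|` of growth (b).
  have h0 : w.count 0 ≠ ∑ i, w.count i := by
    rw [sum_count_eq_length, Ne, List.count_eq_length]
    push Not
    obtain ⟨i, hi, hi0⟩ := hne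
    exact ⟨i, hi, hi0.symm⟩
  obtain ⟨C, hC⟩ := h.mixed (fun i => w.count i) h0 ((sum_count_eq_length w).trans_le hw) r
  refine ⟨C.toNNReal, fun y hy x hx => ?_⟩
  have := hC y hy x hx
  rw [multiDeriv_eq_wordDeriv h.contDiffOn hw hx.le _] at this
  exact NNReal.coe_le_coe.1 (this.trans (Real.le_coe_toNNReal C))

theorem GrowthAssumption.l2Growth (h : GrowthAssumption m μ) {l : ℕ} (hl : l ≤ m) :
    L2Growth (wordDeriv μ (List.replicate l 0)) := by
  obtain ⟨a, b, ha, _, hb, hab⟩ := h.pure_x l hl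
  refine ⟨a, ha, fun r => ?_⟩
  obtain ⟨C, hC⟩ := hb r
  refine ⟨C.toNNReal, fun y hy x hx => ?_⟩
  have e : (Pi.single 0 l : Fin (d + 1) → ℕ) = fun i => (List.replicate l 0).count i := by
    funext i
    rw [List.count_replicate, Pi.single_apply]
    simp only [beq_iff_eq, eq_comm (a := i)]
  have := hab x hx y
  rw [e, multiDeriv_eq_wordDeriv h.contDiffOn (by simpa using hl) hx.le _] at this
  refine this.trans ?_
  gcongr
  exact (hC y hy).trans (Real.le_coe_toNNReal C)

end

section
variable {X : Type*} [PseudoMetricSpace X] {d : ℕ} {m : ℕ}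
  {μ : ℝ × EuclideanSpace ℝ (Fin d) → ℝ}

/-- Differentiating `D^w μ(x, U) W` gives terms of the same shape, with words `0 :: w`, `j.succ ::
w` and `w` and factors `W`, `U_j' W` and `W'`. Each word keeps a `y`-direction, so its coefficient
stays bounded. It gains at most one letter while `k` drops by one, so `w.length + k ≤ m` persists.
-/
theorem SobLip.wordDeriv_mul (hgrowth : GrowthAssumption m μ) (hlip : LipschitzAssumption m μ)
    {U : Fin d → X → ℝ → ℝ} {k : ℕ} (hU : ∀ j, SobLip (k + 1) (U j)) {W : X → ℝ → ℝ}
    (hW : SobLip k W) {w : List (Fin (d + 1))} (hw : w.length + k ≤ m) (hne : ∃ i ∈ w, i ≠ 0) :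
    SobLip k (fun u x => nemytskii (wordDeriv μ w) (vecFun fun j => U j u) x * W u x) := by
  induction k generalizing w W with
  | zero =>
    have hb : LinfLip (fun u => nemytskii (wordDeriv μ w) (vecFun fun j => U j u)) :=
      LinfLip.nemytskii (contDiffOn_wordDeriv hgrowth.contDiffOn w hw).continuousOn
        (hlip.unifLocLip (by omega)) (hgrowth.unifLocBdd (by omega) hne)
        (fun j => (hU j).linfLip) fun j u => (hU j).continuousOn u
    simpa only [mul_comm] using! L2Lip.mul hW hb
  | succ k ih =>
    have hb : LinfLip (fun u => nemytskii (wordDeriv μ w) (vecFun fun j => U j u)) :=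
      LinfLip.nemytskii (contDiffOn_wordDeriv hgrowth.contDiffOn w hw).continuousOn
        (hlip.unifLocLip (by omega)) (hgrowth.unifLocBdd (by omega) hne)
        (fun j => (hU j).linfLip) fun j u => (hU j).continuousOn u
    have hU1 := fun j => (hU j).of_succ
    have hW1 := hW
    have hWk := hW.of_succ
    choose U' hUd hU' using fun j => (hU j).2
    obtain ⟨W0, W', hWd, hW'⟩ := hW
    have hν : ContDiffOn ℝ 1 (wordDeriv μ w) (halfSpace d) :=
      contDiffOn_wordDeriv hgrowth.contDiffOn w (k := 1) (by omega)
    refine ⟨by simpa only [mul_comm] using W0.mul hb, _, fun u =>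
      (HasACDeriv.nemytskii hν fun j => hUd j u).mul (hWd u), ?_⟩
    have t0 := ih hU1 hWk (w := 0 :: w) (by simpa using by omega)
      (by obtain ⟨i, hi, h0⟩ := hne; exact ⟨i, by simp [hi], h0⟩)
    have t1 := SobLip.sum Finset.univ fun (j : Fin d) _ =>
      ih hU1 (W := fun u x => U' j u x * W u x) ((hU' j).of_succ.mul hW1) (w := j.succ :: w)
        (by simpa using by omega) ⟨j.succ, by simp, Fin.succ_ne_zero j⟩
    have t2 := ih hU1 hW' (w := w) (by omega) hne
    refine cast ?_ ((t0.add t1).add t2)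
    congr 1
    funext u x
    simp only [nemytskii, wordDeriv, add_mul, Finset.sum_mul, mul_assoc]

/-- The derivative is the next pure `x`-derivative, covered by induction, plus mixed terms with
factors `U_j'`, covered by `SobLip.wordDeriv_mul`. The separate hypothesis `hU1` keeps the
components bounded when `k` has dropped to `0`. -/
theorem SobLip.wordDeriv_replicate (hgrowth : GrowthAssumption m μ)
    (hlip : LipschitzAssumption m μ) {U : Fin d → X → ℝ → ℝ} (hU1 : ∀ j, SobLip 1 (U j)) {k : ℕ}
    (hU : ∀ j, SobLip k (U j)) {l : ℕ} (hl : l + k ≤ m) :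
    SobLip k (fun u => nemytskii (wordDeriv μ (List.replicate l 0)) (vecFun fun j => U j u)) := by
  have hb : L2Lip
      (fun u => nemytskii (wordDeriv μ (List.replicate l 0)) (vecFun fun j => U j u)) :=
    L2Lip.nemytskii (contDiffOn_wordDeriv hgrowth.contDiffOn _ (k := k) (by simpa)).continuousOn
      (hlip.unifLocLip (by simpa using by omega)) (hgrowth.l2Growth (by omega))
      (fun j => (hU1 j).linfLip) (fun j => (hU j).l2Lip) fun j u => (hU1 j).continuousOn u
  induction k generalizing l with
  | zero => exact hb
  | succ k ih =>
    have hUk := fun j => (hU j).of_succ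
    choose U' hUd hU' using fun j => (hU j).2
    have hν : ContDiffOn ℝ 1 (wordDeriv μ (List.replicate l 0)) (halfSpace d) :=
      contDiffOn_wordDeriv hgrowth.contDiffOn _ (k := 1) (by simpa using by omega)
    refine ⟨hb, _, fun u => HasACDeriv.nemytskii hν fun j => hUd j u, ?_⟩
    have hl' : l + 1 + k ≤ m := by omega
    have t0 := ih hUk hl' (L2Lip.nemytskii
      (contDiffOn_wordDeriv hgrowth.contDiffOn _ (k := k) (by simpa)).continuousOn
      (hlip.unifLocLip (by simpa using by omega)) (hgrowth.l2Growth (by omega))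
      (fun j => (hU1 j).linfLip) (fun j => (hU j).l2Lip) fun j u => (hU1 j).continuousOn u)
    have t1 := SobLip.sum Finset.univ fun (j : Fin d) _ =>
      SobLip.wordDeriv_mul hgrowth hlip hU (hU' j) (w := j.succ :: List.replicate l 0)
        (by simpa using by omega) ⟨j.succ, by simp, Fin.succ_ne_zero j⟩
    exact t0.add t1

end

/-! ### Passage to Sobolev spaces -/

/-- The derivatives of order `< m` of a Sobolev function have absolutely continuous
representatives. -/
theorem SobolevSpace.exists_representatives {m : ℕ} (u : SobolevSpace m) :
    ∃ G : ℕ → ℝ → ℝ, (∀ k : Fin (m + 1), G k =ᵐ[halfLine] (u.1 k : Lp ℝ 2 halfLine)) ∧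
      ∀ i < m, HasACDeriv (G i) (G (i + 1)) := by
  have hex : ∀ k : ℕ, ∃ F : ℝ → ℝ, ∀ hk : k < m + 1,
      F =ᵐ[halfLine] (u.1 ⟨k, hk⟩ : Lp ℝ 2 halfLine) ∧
      ∀ hk' : k + 1 < m + 1, HasACDeriv F (u.1 ⟨k + 1, hk'⟩ : Lp ℝ 2 halfLine) := by
    intro k
    by_cases hk' : k + 1 < m + 1
    · have hk : k < m + 1 := by omega
      obtain ⟨F, h1, h2⟩ := IsWeakDeriv.exists_hasACDeriv (Lp.memLp (u.1 ⟨k, hk⟩))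
        (Lp.memLp (u.1 ⟨k + 1, hk'⟩)) ((u.2 ⟨k, hk⟩).succ_of (u.2 ⟨k + 1, hk'⟩))
      exact ⟨F, fun _ => ⟨h1, fun _ => h2⟩⟩
    · by_cases hk : k < m + 1
      · exact ⟨(u.1 ⟨k, hk⟩ : Lp ℝ 2 halfLine), fun _ => ⟨.rfl, fun h => absurd h hk'⟩⟩
      · exact ⟨0, fun h => absurd h hk⟩
  choose G hG using hex
  refine ⟨G, fun k => (hG k k.2).1, fun i hi => ?_⟩
  exact ((hG i (by omega)).2 (by omega)).congr_right (hG (i + 1) (by omega)).1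

theorem SobolevSpace.nnnorm_apply_le {m : ℕ} (u : SobolevSpace m) (k : Fin (m + 1)) :
    ‖u.1 k‖₊ ≤ ‖u‖₊ :=
  PiLp.nnnorm_apply_le u.1 k

theorem SobolevSpace.nndist_le_sum {m : ℕ} (u v : SobolevSpace m) :
    nndist u v ≤ ∑ k, nndist (u.1 k) (v.1 k) := by
  rw [Subtype.nndist_eq, ← NNReal.coe_le_coe, coe_nndist, PiLp.dist_eq_of_L2]
  push_cast
  refine (Real.sqrt_le_sqrt (Finset.sum_sq_le_sq_sum_of_nonneg fun k _ => dist_nonneg)).trans ?_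
  rw [Real.sqrt_sq (by positivity)]

theorem Lp.eLpNorm_sub_eq_nndist {f g : ℝ → ℝ} {F G : Lp ℝ 2 halfLine} (hf : f =ᵐ[halfLine] F)
    (hg : g =ᵐ[halfLine] G) : eLpNorm (fun x => f x - g x) 2 halfLine = nndist F G := by
  rw [← edist_nndist, Lp.edist_def]
  refine eLpNorm_congr_ae ?_
  filter_upwards [hf, hg] with x h1 h2
  simp [h1, h2]

/-- The components of the elements of a bounded set of `(H^m)^d` have representatives forming
bounded Lipschitz families. -/
theorem SobolevSpacePow.exists_sobLip {m d : ℕ} {B : Set (SobolevSpacePow m d)}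
    (hB : Bornology.IsBounded B) :
    ∃ U : Fin d → B → ℝ → ℝ, (∀ j, SobLip m (U j)) ∧
      ∀ j u, U j u =ᵐ[halfLine] (u.1 j).toFun := by
  choose G hG hGd using fun v : SobolevSpace m => v.exists_representatives
  obtain ⟨R, hR⟩ := hB.exists_norm_le
  refine ⟨fun j u => G (u.1 j) 0, fun j => ?_, fun j u => hG (u.1 j) 0⟩
  refine sobLip_of_seq (G := fun i (u : B) => G (u.1 j) i) (fun i hi => ?_)
    fun i hi u => hGd _ i hi
  have hGi : ∀ v, G v i =ᵐ[halfLine] (v.1 ⟨i, by omega⟩ : Lp ℝ 2 halfLine) :=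
    fun v => hG v ⟨i, by omega⟩
  -- The Lipschitz constant is `1` because passing to a component and to one of its derivatives does
  -- not increase norms.
  refine ⟨fun u => (memLp_congr_ae (hGi _)).2 (Lp.memLp _), ⟨R.toNNReal, fun u => ?_⟩,
    ⟨1, fun u v => ?_⟩⟩
  · rw [eLpNorm_congr_ae (hGi _), ← Lp.enorm_def, enorm_eq_nnnorm, ENNReal.coe_le_coe]
    refine (SobolevSpace.nnnorm_apply_le _ _).trans ((PiLp.nnnorm_apply_le u.1 j).trans ?_)
    exact NNReal.coe_le_coe.1 ((hR u.1 u.2).trans (Real.le_coe_toNNReal R))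
  · rw [Lp.eLpNorm_sub_eq_nndist (hGi _) (hGi _), ENNReal.coe_le_coe, one_mul, nndist_eq_nnnorm,
      Subtype.nndist_eq, nndist_eq_nnnorm]
    have h1 := SobolevSpace.nnnorm_apply_le (u.1 j - v.1 j) ⟨i, by omega⟩
    have h2 := PiLp.nnnorm_apply_le (u.1 - v.1) j
    exact h1.trans h2

/-- A bounded Lipschitz family in `H^m` is a Lipschitz map into the Sobolev space. -/
theorem SobLip.exists_lipschitzWith {X : Type*} [PseudoMetricSpace X] {m : ℕ} {Φ : X → ℝ → ℝ}
    (h : SobLip m Φ) : ∃ N : X → SobolevSpace m, (∀ u, (N u).toFun =ᵐ[halfLine] Φ u) ∧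
      ∃ K : ℝ≥0, LipschitzWith K N := by
  obtain ⟨G, rfl, hG, hGd⟩ := h.exists_seq
  have hmem : ∀ (k : Fin (m + 1)) u, MemLp (G k u) 2 halfLine :=
    fun k u => (hG k (by omega)).memLp u
  refine ⟨fun u => ⟨WithLp.toLp 2 fun k => (hmem k u).toLp, fun k => ?_⟩,
    fun u => (hmem 0 u).coeFn_toLp, ?_⟩
  · exact (isWeakDeriv_of_hasACDeriv (G := fun i => G i u) fun i hi => hGd i (by omega) u).congr
      (hmem 0 u).coeFn_toLp (hmem k u).coeFn_toLp
  · choose K hK using fun k : Fin (m + 1) => (hG k (by omega)).lip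
    refine ⟨∑ k, K k, fun u v => ?_⟩
    rw [edist_nndist, edist_nndist, ← ENNReal.coe_mul, ENNReal.coe_le_coe, Finset.sum_mul]
    refine (SobolevSpace.nndist_le_sum _ _).trans (Finset.sum_le_sum fun k _ => ?_)
    rw [← ENNReal.coe_le_coe, ← Lp.eLpNorm_sub_eq_nndist (hmem k u).coeFn_toLp.symm
      (hmem k v).coeFn_toLp.symm]
    exact hK k u v

/-- The empty word with `k = m` and `X = B`; `1 ≤ m` supplies the boundedness of the components. -/
theorem exists_nemytskii_lipschitzWith {d m : ℕ} (hm : 1 ≤ m)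
    {μ : ℝ × EuclideanSpace ℝ (Fin d) → ℝ}
    (hgrowth : GrowthAssumption m μ) (hlip : LipschitzAssumption m μ)
    {B : Set (SobolevSpacePow m d)} (hB : Bornology.IsBounded B) :
    ∃ N : B → SobolevSpace m, (∀ u, (N u).toFun =ᵐ[halfLine] nemytskii μ u.1.toFun) ∧
      ∃ K : ℝ≥0, LipschitzWith K N := by
  obtain ⟨U, hU, hUae⟩ := SobolevSpacePow.exists_sobLip hB
  obtain ⟨N, hN, hK⟩ := (SobLip.wordDeriv_replicate hgrowth hlip (fun j => (hU j).of_le hm) hU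
    (l := 0) (by omega)).exists_lipschitzWith
  refine ⟨N, fun u => (hN u).trans ?_, hK⟩
  filter_upwards [ae_all_iff.2 fun j => hUae j u] with x hx
  simp only [nemytskii, List.replicate_zero, wordDeriv, vecFun, SobolevSpacePow.toFun, hx]

theorem mainTheorem9 (d m : ℕ) (hm : 1 ≤ m) (μ : ℝ × EuclideanSpace ℝ (Fin d) → ℝ)
    (hgrowth : GrowthAssumption m μ) (hlip : LipschitzAssumption m μ) :
    ∃ N : SobolevSpacePow m d → SobolevSpace m,
      (∀ u : SobolevSpacePow m d, (N u).toFun =ᵐ[halfLine] nemytskii μ u.toFun) ∧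
      ∀ B : Set (SobolevSpacePow m d), Bornology.IsBounded B →
        ∃ K : ℝ≥0, LipschitzOnWith K N B := by
  -- The global operator is chosen pointwise, using singletons as bounded sets. Uniqueness of the
  -- Sobolev element with a given underlying function then identifies its restriction to `B` with
  -- the Lipschitz map obtained on `B`.
  have hex : ∀ u : SobolevSpacePow m d,
      ∃ n : SobolevSpace m, n.toFun =ᵐ[halfLine] nemytskii μ u.toFun := fun u => by
    obtain ⟨N, hN, -⟩ := exists_nemytskii_lipschitzWith hm hgrowth hlip
      (Bornology.isBounded_singleton (x := u))
    exact ⟨N ⟨u, rfl⟩, hN ⟨u, rfl⟩⟩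
  choose N hN using hex
  refine ⟨N, hN, fun B hB => ?_⟩
  obtain ⟨N', hN', K, hK⟩ := exists_nemytskii_lipschitzWith hm hgrowth hlip hB
  refine ⟨K, lipschitzOnWith_iff_restrict.2 ?_⟩
  have e : B.domRestrict N = N' :=
    funext fun u => sobolevSpace_ext ((hN u.1).trans (hN' u).symm)
  rwa [e]
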